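/- Let $F:\mathbb{R}^d\to\mathbb{R}$ be bounded below, and let $L_0,L_1,\sigma\ge 0$. Suppose that $F$ is $(L_0,L_1)$-smooth, i.e. $F$ is differentiable and for every $c>0$ and all $x,y\in\mathbb{R}^d$ with $L_1\|x-y\|\le c$, $$\|\nabla F(x)-\nabla F(y)\|\le\Bigl(\bigl(1+e^c-\tfrac{e^c-1}{c}\bigr)L_0+\tfrac{e^c-1}{c}\,L_1\|\nabla F(x)\|\Bigr)\|x-y\| .$$ Let $g(x,\xi)$, with $\xi$ of law $\mathcal{D}$, be a (jointly measurable) stochastic gradient of $F$ with variance bounded by $\sigma^2$: for every $x\in\mathbb{R}^d$, $\mathbb{E}[g(x,\xi)]=\nabla F(x)$ and $\mathbb{E}\|g(x,\xi)-\nabla F(x)\|^2\le\sigma^2$. Let $\eta>0$, $\beta_t=1-t^{-1/2}$ and $\eta_t=\eta\,t^{-3/4}$ for $t\ge1$. Normalized SGD with momentum (NSGD-M) with deterministic starting point $x_1\in\mathbb{R}^d$ and i.i.d. samples $\xi_1,\xi_2,\dots$ of law $\mathcal{D}$ is the iteration, for $t=1,2,\dots$, $$m_t=\beta_t m_{t-1}+(1-\beta_t)\,g(x_t,\xi_t),\qquad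 x_{t+1}=x_t-\eta_t\,\frac{m_t}{\|m_t\|},\qquad m_0=0,$$ with the convention $0/\|0\|=0$. Put $\Delta_1=F(x_1)-\inf F$. Then every $\|\nabla F(x_t)\|$ is integrable, and for every integer $T\ge1$, $$\sum_{t=1}^{T}\frac{\eta_t}{2}\,\mathbb{E}\|\nabla F(x_t)\|\le \Delta_1+\eta\sigma\bigl(7+2\sqrt{2e^2}\log T\bigr)+\eta^2L_0\Bigl(45\,\frac{e^{\eta L_1}-1}{\eta L_1}+14\log T\Bigr)+21\,\eta^2L_0\,e^{48(\eta L_1)^2}+6\,\eta\, e^{48(\eta L_1)^2}\|\nabla F(x_1)\|,$$ where $\frac{e^{\eta L_1}-1}{\eta L_1}$ is read as its limit $1$ if $L_1=0$. Furthermore, if $L_1\ge\frac{1}{2\eta}$, the same inequality holds with the last term $6\,\eta\, e^{48(\eta L_1)^2}\|\nabla F(x_1)\|$ replaced by $\frac{e^{48(\eta L_1)^2}}{L_1}\|\nabla F(x_1)\|$. -/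

import Mathlib

open MeasureTheory ProbabilityTheory

noncomputable section

/-- The function `c ↦ 1 + e^c - (e^c - 1)/c` (used for `c > 0`). -/
def smoothA0 (c : ℝ) : ℝ := 1 + Real.exp c - (Real.exp c - 1) / c

/-- The function `c ↦ (e^c - 1)/c` (used for `c > 0`). -/
def smoothA1 (c : ℝ) : ℝ := (Real.exp c - 1) / c

/-- `(L0, L1)`-smoothness of a differentiable function, without second derivatives: for every
`c > 0` and all `x, y` with `L1 ‖x - y‖ ≤ c`,
`‖∇F(x) - ∇F(y)‖ ≤ (A0(c) L0 + A1(c) L1 ‖∇F(x)‖) ‖x - y‖`. -/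
def IsL0L1Smooth {d : ℕ} (L0 L1 : ℝ) (F : EuclideanSpace ℝ (Fin d) → ℝ) : Prop :=
  Differentiable ℝ F ∧
    ∀ c : ℝ, 0 < c → ∀ x y : EuclideanSpace ℝ (Fin d), L1 * ‖x - y‖ ≤ c →
      ‖gradient F x - gradient F y‖ ≤
        (smoothA0 c * L0 + smoothA1 c * L1 * ‖gradient F x‖) * ‖x - y‖

/-- `g x s` is the stochastic gradient at the point `x` for the sample `s`, with `s` of law `D`:
it is an unbiased estimator of `∇F(x)` with variance at most `σ ^ 2`. -/
structure IsStochasticGradient {d : ℕ} {S : Type*} [MeasurableSpace S] (D : Measure S)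
    (F : EuclideanSpace ℝ (Fin d) → ℝ)
    (g : EuclideanSpace ℝ (Fin d) → S → EuclideanSpace ℝ (Fin d)) (σ : ℝ) : Prop where
  measurable : Measurable (Function.uncurry g)
  integrable : ∀ x, Integrable (g x) D
  unbiased : ∀ x, ∫ s, g x s ∂D = gradient F x
  sq_integrable : ∀ x, Integrable (fun s => ‖g x s - gradient F x‖ ^ 2) D
  variance_le : ∀ x, ∫ s, ‖g x s - gradient F x‖ ^ 2 ∂D ≤ σ ^ 2

/-- Normalized SGD with momentum: after `t` steps the state is the pair `(x_{t+1}, m_t)`, where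
`m_0 = 0`, `m_t = β_t m_{t-1} + (1 - β_t) g(x_t, ξ_t)` and
`x_{t+1} = x_t - η_t m_t / ‖m_t‖` (no step is made if `m_t = 0`). Step sizes, momentum
parameters and samples are indexed from `1` (their entries at `0` are never used). -/
def nsgdmState {d : ℕ} {S : Type*} (η β : ℕ → ℝ)
    (g : EuclideanSpace ℝ (Fin d) → S → EuclideanSpace ℝ (Fin d))
    (x₁ : EuclideanSpace ℝ (Fin d)) (ξ : ℕ → S) :
    ℕ → EuclideanSpace ℝ (Fin d) × EuclideanSpace ℝ (Fin d)
  | 0 => (x₁, 0)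
  | t + 1 =>
    let x := (nsgdmState η β g x₁ ξ t).1
    let m := β (t + 1) • (nsgdmState η β g x₁ ξ t).2 + (1 - β (t + 1)) • g x (ξ (t + 1))
    (x - η (t + 1) • (‖m‖⁻¹ • m), m)

/-- The iterate `x_t` (for `t ≥ 1`) of normalized SGD with momentum. -/
def nsgdmIterate {d : ℕ} {S : Type*} (η β : ℕ → ℝ)
    (g : EuclideanSpace ℝ (Fin d) → S → EuclideanSpace ℝ (Fin d))
    (x₁ : EuclideanSpace ℝ (Fin d)) (ξ : ℕ → S) (t : ℕ) : EuclideanSpace ℝ (Fin d) :=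
  (nsgdmState η β g x₁ ξ (t - 1)).1

/-- The momentum parameters `β_t = 1 - t^{-1/2}`. -/
def momentumParam (t : ℕ) : ℝ := 1 - (t : ℝ) ^ (-(1 / 2) : ℝ)

/-- The step sizes `η_t = η t^{-3/4}`. -/
def stepSize (η : ℝ) (t : ℕ) : ℝ := η * (t : ℝ) ^ (-(3 / 4) : ℝ)

/-- `(e^x - 1)/x`, extended continuously by `1` at `x = 0`. -/
def expQuot (x : ℝ) : ℝ := if x = 0 then 1 else (Real.exp x - 1) / x

end

/-! ### Smoothness -/

/-! Write q_t = t^(-1/4) and a = η L1, so that η_t = η q_t^3, 1 - β_t = q_t^2 and η_t q_t = η / t.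
The error m_t - ∇F(x_t) splits into an averaged noise N_t and a drift that contains no fresh noise
(`nsgdm_drift_step`). The descent inequality loses 2 η_t times the norm of each, plus η_t b_t, where
b_t bounds the change of the gradient in step t.

Noise: unbiasedness and independence remove the cross term, and `variance_step` propagates E‖N_t‖^2
≤ q_t^2 σ^2. Hence the noise costs a harmonic sum, that is, a logarithm.

Drift: it contracts by β_{t+1} and is fed by b_t, so weighted summation (`sum_drift_le`) leaves 3 η
∑ q_t b_t in all. The L0 part of b_t again gives a harmonic sum and a convergent one. The part
proportional to ‖∇F(x_t)‖ is handled in `sum_gradientChange_le`. Once a q_t ≤ 1/7 it is at most half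
of η_t ‖∇F(x_t)‖ and is absorbed on the left. Before that, t < (7a)^4; since every step has length
at most η_s, the iterate is within 28 η a of x_1, and the gradient is at most exp(28 a^2) (‖∇F(x_1)‖
+ 28 η a L0). This initial phase is the origin of the exponential constants, and it needs no
knowledge of L1 in the step size. -/

lemma exp_sub_one_le_mul_exp (c : ℝ) : Real.exp c - 1 ≤ c * Real.exp c := by
  have h := Real.add_one_le_exp (-c)
  have h2 : Real.exp (-c) * Real.exp c = 1 := by rw [← Real.exp_add]; simp
  nlinarith [Real.exp_pos c]

lemma smoothA0_le_exp {c : ℝ} (hc : 0 < c) : smoothA0 c ≤ Real.exp c := by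
  have h : 1 ≤ (Real.exp c - 1) / c := by
    rw [le_div_iff₀ hc]; linarith [Real.add_one_le_exp c]
  unfold smoothA0; linarith

/-- Explicit form of `(L0, L1)`-smoothness on a ball of radius `r`. -/
lemma IsL0L1Smooth.norm_gradient_sub_le {d : ℕ} {L0 L1 : ℝ} {F : EuclideanSpace ℝ (Fin d) → ℝ}
    (h : IsL0L1Smooth L0 L1 F) (hL0 : 0 ≤ L0) (hL1 : 0 ≤ L1) {x y : EuclideanSpace ℝ (Fin d)}
    {r : ℝ} (hr : ‖x - y‖ ≤ r) :
    ‖gradient F x - gradient F y‖ ≤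
      Real.exp (L1 * r) * L0 * r + (Real.exp (L1 * r) - 1) * ‖gradient F x‖ := by
  have hr0 : 0 ≤ r := (norm_nonneg _).trans hr
  rcases hL1.eq_or_lt with h1 | h1
  · subst h1
    -- With L1 = 0 the natural choice c = L1 * r is not positive; every c > 0 is admissible, so let
    -- c tend to 0.
    have key : ‖gradient F x - gradient F y‖ ≤ Real.exp 0 * L0 * r := by
      have hlim : Filter.Tendsto (fun c : ℝ => Real.exp c * L0 * r)
          (nhdsWithin 0 (Set.Ioi 0)) (nhds (Real.exp 0 * L0 * r)) := by
        apply Filter.Tendsto.mono_left _ nhdsWithin_le_nhds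
        exact (Continuous.tendsto (by fun_prop) 0)
      refine ge_of_tendsto hlim ?_
      filter_upwards [self_mem_nhdsWithin] with c hc
      have hc : 0 < c := hc
      have := h.2 c hc x y (by simpa using hc.le)
      refine this.trans ?_
      simp only [mul_zero, zero_mul, add_zero]
      gcongr
      exact smoothA0_le_exp hc
    simpa using key
  · rcases hr0.eq_or_lt with h0 | h0
    · subst h0
      have : x = y := by simpa [sub_eq_zero] using hr
      simp [this]
    · have hc : 0 < L1 * r := mul_pos h1 h0
      have := h.2 (L1 * r) hc x y (by gcongr)
      refine this.trans ?_
      have hA1 : smoothA1 (L1 * r) * L1 * r = Real.exp (L1 * r) - 1 := by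
        unfold smoothA1; field_simp
      have hA1' : 0 ≤ smoothA1 (L1 * r) := by
        unfold smoothA1
        exact div_nonneg (by linarith [Real.add_one_le_exp (L1 * r)]) hc.le
      calc _ ≤ (Real.exp (L1 * r) * L0 + smoothA1 (L1 * r) * L1 * ‖gradient F x‖) * ‖x - y‖ := by
            gcongr; exact smoothA0_le_exp hc
        _ ≤ (Real.exp (L1 * r) * L0 + smoothA1 (L1 * r) * L1 * ‖gradient F x‖) * r := by gcongr
        _ = _ := by rw [← hA1]; ring

lemma IsL0L1Smooth.norm_gradient_le {d : ℕ} {L0 L1 : ℝ} {F : EuclideanSpace ℝ (Fin d) → ℝ}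
    (h : IsL0L1Smooth L0 L1 F) (hL0 : 0 ≤ L0) (hL1 : 0 ≤ L1) {x y : EuclideanSpace ℝ (Fin d)}
    {r : ℝ} (hr : ‖y - x‖ ≤ r) :
    ‖gradient F y‖ ≤ Real.exp (L1 * r) * (‖gradient F x‖ + L0 * r) := by
  have h1 := h.norm_gradient_sub_le hL0 hL1 (x := x) (y := y) (r := r)
    (by rwa [norm_sub_rev])
  have h2 := norm_sub_norm_le (gradient F y) (gradient F x)
  rw [norm_sub_rev] at h2
  nlinarith

/-- The descent inequality. -/
lemma IsL0L1Smooth.le_add_inner {d : ℕ} {L0 L1 : ℝ} {F : EuclideanSpace ℝ (Fin d) → ℝ}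
    (h : IsL0L1Smooth L0 L1 F) (hL0 : 0 ≤ L0) (hL1 : 0 ≤ L1) {x y : EuclideanSpace ℝ (Fin d)}
    {r : ℝ} (hr : ‖y - x‖ ≤ r) :
    F y ≤ F x + inner ℝ (gradient F x) (y - x) +
      r * (Real.exp (L1 * r) * L0 * r + (Real.exp (L1 * r) - 1) * ‖gradient F x‖) := by
  have hr0 : 0 ≤ r := (norm_nonneg _).trans hr
  set C := Real.exp (L1 * r) * L0 * r + (Real.exp (L1 * r) - 1) * ‖gradient F x‖ with hC
  have hC0 : 0 ≤ C := by
    have : 0 ≤ Real.exp (L1 * r) - 1 := by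
      linarith [Real.add_one_le_exp (L1 * r), mul_nonneg hL1 hr0]
    positivity
  have hfd : ∀ z, fderiv ℝ F z = InnerProductSpace.toDual ℝ _ (gradient F z) := fun z => by
    simp [gradient]
  -- The mean value inequality for F minus its linearization at x replaces integration along the
  -- segment. It loses a factor 2 in the remainder, which the final constants can afford.
  have key := (convex_closedBall x r).norm_image_sub_le_of_norm_hasFDerivWithin_le'
    (f := F) (f' := fderiv ℝ F) (φ := fderiv ℝ F x) (C := C) (x := x) (y := y)
    (fun z _ => (h.1 z).hasFDerivAt.hasFDerivWithinAt)
    (fun z hz => by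
      rw [hfd, hfd, ← map_sub, LinearIsometryEquiv.norm_map, norm_sub_rev]
      exact h.norm_gradient_sub_le hL0 hL1 (by rwa [norm_sub_rev, ← dist_eq_norm]))
    (Metric.mem_closedBall_self hr0) (by simpa [dist_eq_norm] using hr)
  rw [hfd, InnerProductSpace.toDual_apply_apply] at key
  have k2 := (le_abs_self _).trans key
  have : C * ‖y - x‖ ≤ r * C := by rw [mul_comm]; gcongr
  linarith

/-- Pairing m with its own direction gives ‖m‖; replacing m by v costs ‖m - v‖ in the pairing and
once more in the norm. For m = 0 the convention 0⁻¹ = 0 keeps this valid. -/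
lemma inner_normalized_ge {E : Type*} [NormedAddCommGroup E] [InnerProductSpace ℝ E] (v m : E) :
    ‖v‖ - 2 * ‖m - v‖ ≤ inner ℝ v (‖m‖⁻¹ • m) := by
  have h1 : inner ℝ m (‖m‖⁻¹ • m) = ‖m‖ := by
    rcases eq_or_ne m 0 with rfl | hm
    · simp
    · rw [real_inner_smul_right, real_inner_self_eq_norm_sq]
      have : ‖m‖ ≠ 0 := norm_ne_zero_iff.2 hm
      field_simp
  have h2 : ‖‖m‖⁻¹ • m‖ ≤ 1 := by
    rw [norm_smul, norm_inv, norm_norm]; exact inv_mul_le_one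
  have h3 : inner ℝ (m - v) (‖m‖⁻¹ • m) ≤ ‖m - v‖ := by
    refine (real_inner_le_norm _ _).trans ?_
    exact mul_le_of_le_one_right (norm_nonneg _) h2
  rw [inner_sub_left, h1] at h3
  have h4 := norm_sub_norm_le v m
  rw [norm_sub_rev] at h4
  linarith

/-! ### The scale `t ^ (-1/4)` -/

/-- `t ^ (-1/4)`, of which the algorithm parameters are powers. -/
noncomputable def quarterScale (t : ℕ) : ℝ := (t : ℝ) ^ (-(1 / 4) : ℝ)

lemma quarterScale_pos {t : ℕ} (ht : 1 ≤ t) : 0 < quarterScale t :=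
  Real.rpow_pos_of_pos (by exact_mod_cast ht) _

lemma quarterScale_nonneg (t : ℕ) : 0 ≤ quarterScale t := Real.rpow_nonneg (by positivity) _

lemma quarterScale_pow (t : ℕ) (k : ℕ) : quarterScale t ^ k = (t : ℝ) ^ (-(k / 4) : ℝ) := by
  rw [quarterScale, ← Real.rpow_natCast, ← Real.rpow_mul (by positivity)]
  congr 1; ring

lemma quarterScale_pow_four (t : ℕ) : quarterScale t ^ 4 = (t : ℝ)⁻¹ := by
  rw [quarterScale_pow, ← Real.rpow_neg_one]; norm_num

lemma stepSize_eq (η : ℝ) (t : ℕ) : stepSize η t = η * quarterScale t ^ 3 := by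
  rw [quarterScale_pow]; norm_num [stepSize]

lemma momentumParam_eq (t : ℕ) : momentumParam t = 1 - quarterScale t ^ 2 := by
  rw [quarterScale_pow, momentumParam]; norm_num

lemma quarterScale_one : quarterScale 1 = 1 := by simp [quarterScale]

lemma quarterScale_antitone {s t : ℕ} (hs : 1 ≤ s) (hst : s ≤ t) :
    quarterScale t ≤ quarterScale s :=
  Real.rpow_le_rpow_of_nonpos (by exact_mod_cast hs) (by exact_mod_cast hst) (by norm_num)

lemma quarterScale_le_one {t : ℕ} (ht : 1 ≤ t) : quarterScale t ≤ 1 := by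
  simpa [quarterScale_one] using quarterScale_antitone le_rfl ht

/-- This is 1/t - 1/(t+1) = 1/(t(t+1)) in disguise. It is the only link between consecutive scales p
and q beyond monotonicity, and it makes the later estimates polynomial. -/
lemma quarterScale_succ_pow_four {t : ℕ} (ht : 1 ≤ t) :
    quarterScale t ^ 4 * (1 - quarterScale (t + 1) ^ 4) = quarterScale (t + 1) ^ 4 := by
  have : (0 : ℝ) < t := by exact_mod_cast ht
  rw [quarterScale_pow_four, quarterScale_pow_four]; push_cast; field_simp; ring

/-- The induction step for E‖N_t‖^2 ≤ q_t^2 σ^2. It suffices that (1 - q^2) p^2 ≤ q^2, which after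
squaring follows from (1 - q^2)^2 ≤ 1 - q^4. -/
lemma variance_step {t : ℕ} (ht : 1 ≤ t) :
    (1 - quarterScale (t + 1) ^ 2) ^ 2 * quarterScale t ^ 2 + (quarterScale (t + 1) ^ 2) ^ 2 ≤
      quarterScale (t + 1) ^ 2 := by
  have h := quarterScale_succ_pow_four ht
  have hq0 := quarterScale_nonneg (t + 1)
  have hq1 := quarterScale_le_one (t := t + 1) (by omega)
  set q := quarterScale (t + 1)
  set p := quarterScale t
  have hq2 : q ^ 2 ≤ 1 := pow_le_one₀ hq0 hq1
  have h1 : (1 - q ^ 2) * p ^ 2 ≤ q ^ 2 := by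
    refine le_of_sq_le_sq ?_ (by positivity)
    have : (1 - q ^ 2) ^ 2 ≤ 1 - q ^ 4 := by nlinarith [sq_nonneg q]
    have h2 : p ^ 4 * (1 - q ^ 2) ^ 2 ≤ p ^ 4 * (1 - q ^ 4) := by gcongr
    nlinarith
  nlinarith [mul_le_mul_of_nonneg_left h1 (sub_nonneg.2 hq2)]

/-- Telescoping against 4 n^(1/4), the integral of t^(-3/4). Multiplied by η, it bounds the distance
travelled. -/
lemma sum_quarterScale_pow_three_le {n : ℕ} (hn : 1 ≤ n) :
    ∑ t ∈ Finset.Icc 1 n, quarterScale t ^ 3 ≤ 4 / quarterScale n - 3 := by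
  induction n, hn using Nat.le_induction with
  | base => norm_num [quarterScale_one]
  | succ n hn ih =>
    rw [Finset.sum_Icc_succ_top (by omega)]
    have hp := quarterScale_pos hn
    have hq := quarterScale_pos (t := n + 1) (by omega)
    have hqp := quarterScale_antitone hn (Nat.le_succ n)
    have h := quarterScale_succ_pow_four hn
    simp only [Nat.succ_eq_add_one] at hqp
    set q := quarterScale (n + 1)
    set p := quarterScale n
    have h1 : q ^ 3 ≤ 4 / q - 4 / p := by
      rw [div_sub_div _ _ hq.ne' hp.ne', le_div_iff₀ (by positivity)]
      have h3 : p ^ 3 * (q ^ 4 * p) ≤ p ^ 3 * (4 * (p - q)) := by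
        have : p ^ 3 * (q ^ 4 * p) = (p - q) * (p + q) * (p ^ 2 + q ^ 2) := by linarith
        rw [this]
        have : (p + q) * (p ^ 2 + q ^ 2) ≤ 4 * p ^ 3 := by
          have : (p + q) * (p ^ 2 + q ^ 2) ≤ (p + p) * (p ^ 2 + p ^ 2) := by gcongr
          linarith
        nlinarith [mul_le_mul_of_nonneg_left this (sub_nonneg.2 hqp)]
      have := le_of_mul_le_mul_left h3 (by positivity)
      nlinarith
    linarith

lemma sum_quarterScale_pow_four_le (n : ℕ) :
    ∑ t ∈ Finset.Icc 1 n, quarterScale t ^ 4 ≤ 1 + Real.log n := by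
  have := harmonic_le_one_add_log n
  rw [harmonic_eq_sum_Icc] at this
  simpa [quarterScale_pow_four] using this

lemma sum_quarterScale_pow_seven_le {n : ℕ} (hn : 1 ≤ n) :
    ∑ t ∈ Finset.Icc 1 n, quarterScale t ^ 7 ≤ 3 - 2 * quarterScale n ^ 2 := by
  induction n, hn using Nat.le_induction with
  | base => norm_num [quarterScale_one]
  | succ n hn ih =>
    rw [Finset.sum_Icc_succ_top (by omega)]
    have hp := quarterScale_pos hn
    have hq := quarterScale_pos (t := n + 1) (by omega)
    have hq1 := quarterScale_le_one (t := n + 1) (by omega)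
    have hqp := quarterScale_antitone hn (Nat.le_succ n)
    have h := quarterScale_succ_pow_four hn
    simp only [Nat.succ_eq_add_one] at hqp
    set q := quarterScale (n + 1)
    set p := quarterScale n
    have h0 : q ^ 7 ≤ q ^ 6 := pow_le_pow_of_le_one hq.le hq1 (by norm_num)
    have h1 : q ^ 6 ≤ 2 * (p ^ 2 - q ^ 2) := by
      have h3 : (p ^ 2 - q ^ 2) * (p ^ 2 + q ^ 2) = p ^ 4 * q ^ 4 := by linarith
      have h4 : q ^ 2 ≤ p ^ 2 := by gcongr
      have h5 : p ^ 2 * (p ^ 2 * q ^ 4) ≤ p ^ 2 * (2 * (p ^ 2 - q ^ 2)) := by nlinarith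
      have h6 := le_of_mul_le_mul_left h5 (by positivity)
      have h7 : q ^ 2 * q ^ 4 ≤ p ^ 2 * q ^ 4 := by gcongr
      nlinarith
    linarith

/-! ### Estimates for real sequences -/

lemma exp_mul_sub_one_le (a : ℝ) {s : ℝ} (hs0 : 0 ≤ s) (hs1 : s ≤ 1) :
    Real.exp (a * s) - 1 ≤ s * (Real.exp a - 1) := by
  have := convexOn_exp.2 (Set.mem_univ (0 : ℝ)) (Set.mem_univ a) (sub_nonneg.2 hs1) hs0
    (by ring)
  simp only [smul_eq_mul, mul_zero, zero_add, Real.exp_zero, mul_one] at this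
  rw [mul_comm a s]
  linarith

lemma exp_sub_one_le_of_le_inv_seven {c : ℝ} (hc : c ≤ 1 / 7) (hc0 : 0 ≤ c) :
    Real.exp c - 1 ≤ 7 / 6 * c := by
  have h := Real.add_one_le_exp (-c)
  have h2 : Real.exp (-c) * Real.exp c = 1 := by rw [← Real.exp_add]; simp
  nlinarith [Real.exp_pos c]

/-- Summation of the drift recursion against the step sizes. -/
lemma sum_drift_le {δ b : ℕ → ℝ} (hb : ∀ t, 1 ≤ t → 0 ≤ b t) (hδ : ∀ t, 1 ≤ t → 0 ≤ δ t)
    (h1 : δ 1 = 0)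
    (hrec : ∀ t, 1 ≤ t → δ (t + 1) ≤ (1 - quarterScale (t + 1) ^ 2) * (δ t + b t))
    {n : ℕ} (hn : 1 ≤ n) :
    ∑ t ∈ Finset.Icc 1 n, quarterScale t ^ 3 * δ t + quarterScale n * δ n ≤
      ∑ t ∈ Finset.Ico 1 n, quarterScale t * b t := by
  induction n, hn using Nat.le_induction with
  | base => simp [h1]
  | succ n hn ih =>
    rw [Finset.sum_Icc_succ_top (by omega), Finset.sum_Ico_succ_top (by omega)]
    have hq := quarterScale_pos (t := n + 1) (by omega)
    have hqp : quarterScale (n + 1) ≤ quarterScale n := quarterScale_antitone hn (Nat.le_succ n)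
    have hr := hrec n hn
    have hδb : 0 ≤ δ n + b n := add_nonneg (hδ n hn) (hb n hn)
    set q := quarterScale (n + 1)
    -- The potential q_n δ_n pays for the new term because (q^3 + q)(1 - q^2) = q - q^5 stays below
    -- the previous scale.
    have hstep : (q ^ 3 + q) * δ (n + 1) ≤ quarterScale n * (δ n + b n) :=
      calc (q ^ 3 + q) * δ (n + 1) ≤ (q ^ 3 + q) * ((1 - q ^ 2) * (δ n + b n)) := by gcongr
        _ = (q - q ^ 5) * (δ n + b n) := by ring
        _ ≤ quarterScale n * (δ n + b n) := by
            gcongr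
            have : 0 < q ^ 5 := by positivity
            linarith
    linarith

/-- The bound on the change of the gradient in the step `t`, where the gradient has norm `ρ`. -/
noncomputable def gradientChange (η L0 L1 : ℝ) (t : ℕ) (ρ : ℝ) : ℝ :=
  Real.exp (L1 * stepSize η t) * L0 * stepSize η t + (Real.exp (L1 * stepSize η t) - 1) * ρ

lemma stepSize_nonneg {η : ℝ} (hη : 0 < η) (t : ℕ) : 0 ≤ stepSize η t := by
  rw [stepSize_eq]; have := quarterScale_nonneg t; positivity

lemma gradientChange_nonneg {η L0 L1 : ℝ} (hη : 0 < η) (hL0 : 0 ≤ L0) (hL1 : 0 ≤ L1)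
    (t : ℕ) {ρ : ℝ} (hρ : 0 ≤ ρ) : 0 ≤ gradientChange η L0 L1 t ρ := by
  have h := stepSize_nonneg hη t
  have := Real.add_one_le_exp (L1 * stepSize η t)
  have h2 : 0 ≤ Real.exp (L1 * stepSize η t) - 1 := by linarith [mul_nonneg hL1 h]
  unfold gradientChange; positivity

/-- The descent inequality is telescoped. The factor 3 collects 2 from the drift and 1 from the
descent remainder, the latter by q^3 ≤ q. -/
lemma sum_stepSize_mul_le {η : ℝ} (hη : 0 < η) {f ρ ν δ b : ℕ → ℝ}
    (hb : ∀ t, 1 ≤ t → 0 ≤ b t) (hδ : ∀ t, 1 ≤ t → 0 ≤ δ t) (h1 : δ 1 = 0)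
    (hrec : ∀ t, 1 ≤ t → δ (t + 1) ≤ (1 - quarterScale (t + 1) ^ 2) * (δ t + b t))
    (hf : ∀ t, 1 ≤ t → f (t + 1) ≤
      f t - stepSize η t * ρ t + 2 * stepSize η t * (ν t + δ t) + stepSize η t * b t)
    {T : ℕ} (hT : 1 ≤ T) :
    ∑ t ∈ Finset.Icc 1 T, stepSize η t * ρ t ≤ f 1 - f (T + 1) +
      2 * ∑ t ∈ Finset.Icc 1 T, stepSize η t * ν t +
      ∑ t ∈ Finset.Icc 1 T, 3 * η * (quarterScale t * b t) := by
  have htel : ∀ n, ∑ t ∈ Finset.Icc 1 n, stepSize η t * ρ t ≤ f 1 - f (n + 1) +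
      2 * ∑ t ∈ Finset.Icc 1 n, stepSize η t * ν t +
      2 * ∑ t ∈ Finset.Icc 1 n, stepSize η t * δ t +
      ∑ t ∈ Finset.Icc 1 n, stepSize η t * b t := by
    intro n
    induction n with
    | zero => simp
    | succ n ih =>
      simp only [Finset.sum_Icc_succ_top (Nat.le_add_left 1 n)]
      linarith [hf (n + 1) (by omega)]
  have hd := sum_drift_le hb hδ h1 hrec hT
  have hIco : ∑ t ∈ Finset.Ico 1 T, quarterScale t * b t ≤
      ∑ t ∈ Finset.Icc 1 T, quarterScale t * b t :=
    Finset.sum_le_sum_of_subset_of_nonneg Finset.Ico_subset_Icc_self fun t ht _ =>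
      mul_nonneg (quarterScale_nonneg t) (hb t (Finset.mem_Icc.1 ht).1)
  have hlast := mul_nonneg (quarterScale_nonneg T) (hδ T hT)
  have e1 : ∑ t ∈ Finset.Icc 1 T, stepSize η t * δ t =
      η * ∑ t ∈ Finset.Icc 1 T, quarterScale t ^ 3 * δ t := by
    rw [Finset.mul_sum]; exact Finset.sum_congr rfl fun t _ => by rw [stepSize_eq]; ring
  have e2 : ∑ t ∈ Finset.Icc 1 T, stepSize η t * b t ≤
      η * ∑ t ∈ Finset.Icc 1 T, quarterScale t * b t := by
    rw [Finset.mul_sum]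
    refine Finset.sum_le_sum fun t ht => ?_
    have ht1 := (Finset.mem_Icc.1 ht).1
    have hq : quarterScale t ^ 3 ≤ quarterScale t :=
      pow_le_of_le_one (quarterScale_nonneg t) (quarterScale_le_one ht1) (by norm_num)
    rw [stepSize_eq, mul_assoc]
    have := hb t ht1
    gcongr
  have e3 : η * ∑ t ∈ Finset.Icc 1 T, quarterScale t ^ 3 * δ t ≤
      η * ∑ t ∈ Finset.Icc 1 T, quarterScale t * b t :=
    mul_le_mul_of_nonneg_left (by linarith) hη.le
  rw [← Finset.mul_sum]
  linarith [htel T]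

/-- The part of the weights `1 / t` for which the step size is still large. -/
lemma sum_large_step_le {a : ℝ} (ha : 0 ≤ a) (T : ℕ) :
    ∑ t ∈ Finset.Icc 1 T, (if 1 / 7 < a * quarterScale t then quarterScale t ^ 4 else 0) ≤
      28 * a := by
  rw [← Finset.sum_filter]
  -- The condition a q_t > 1/7 means t < (7a)^4.
  set n := ⌊(7 * a) ^ 4⌋₊
  have hsub : Finset.filter (fun t => 1 / 7 < a * quarterScale t) (Finset.Icc 1 T) ⊆
      Finset.Icc 1 n := by
    intro t ht
    rw [Finset.mem_filter, Finset.mem_Icc] at ht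
    refine Finset.mem_Icc.2 ⟨ht.1.1, Nat.le_floor ?_⟩
    have htp : (0 : ℝ) < t := by exact_mod_cast ht.1.1
    have h1 : 1 ≤ (7 * a * quarterScale t) ^ 4 := one_le_pow₀ (by linarith [ht.2])
    rw [mul_pow, quarterScale_pow_four, ← div_eq_mul_inv, le_div_iff₀ htp] at h1
    linarith
  refine (Finset.sum_le_sum_of_subset_of_nonneg hsub fun t _ _ =>
    pow_nonneg (quarterScale_nonneg t) 4).trans ?_
  rcases Nat.eq_zero_or_pos n with h0 | h0
  · simp [h0]; positivity
  · refine (sum_quarterScale_pow_four_le n).trans ?_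
    have hnp : (0 : ℝ) < n := by exact_mod_cast h0
    have hn1 : (1 : ℝ) ≤ n := by exact_mod_cast h0
    have hfl : (n : ℝ) ≤ (7 * a) ^ 4 := Nat.floor_le (by positivity)
    have ha' : 0 < 7 * a := by
      refine lt_of_le_of_ne (by positivity) fun h => ?_
      have := hn1.trans hfl
      rw [← h] at this
      norm_num at this
    -- With log x ≤ x - 1 this gives 1 + log n ≤ 28 a - 3.
    have h1 : Real.log n ≤ 4 * Real.log (7 * a) := by
      refine (Real.log_le_log hnp hfl).trans ?_
      rw [Real.log_pow]; norm_num
    have := Real.log_le_sub_one_of_pos ha'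
    linarith

/-- The gradient change terms are absorbed up to contributions of the initial phase. -/
lemma sum_gradientChange_le {η L0 L1 : ℝ} (hη : 0 < η) (hL0 : 0 ≤ L0) (hL1 : 0 ≤ L1)
    {ρ : ℕ → ℝ} {G : ℝ} (hG : 0 ≤ G) (hρ0 : ∀ t, 1 ≤ t → 0 ≤ ρ t)
    (hρ : ∀ t, 1 ≤ t → ρ t ≤ Real.exp (L1 * (η * (4 / quarterScale t - 3))) *
      (G + L0 * (η * (4 / quarterScale t - 3)))) {T : ℕ} (hT : 1 ≤ T) :
    ∑ t ∈ Finset.Icc 1 T, 3 * η * (quarterScale t * gradientChange η L0 L1 t (ρ t)) ≤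
      (∑ t ∈ Finset.Icc 1 T, stepSize η t * ρ t) / 2 +
      3 * η ^ 2 * L0 * (1 + Real.log T + 3 * (Real.exp (η * L1) - 1)) +
      84 * η * (η * L1) ^ 2 * Real.exp (28 * (η * L1) ^ 2) * (G + 28 * η * (η * L1) * L0) := by
  have ha : 0 ≤ η * L1 := by positivity
  set a := η * L1 with ha_def
  have hea : 0 ≤ Real.exp a - 1 := by linarith [Real.add_one_le_exp a]
  -- The bound on the gradient in the initial phase, where 4 / q - 3 ≤ 28 a - 3. The term -3 a is
  -- kept to offset the factor exp a from exp a - 1 ≤ a exp a below.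
  set R := Real.exp (28 * a ^ 2 - 3 * a) * (G + 28 * η * a * L0) with hR
  have hR0 : 0 ≤ R := by positivity
  have hterm : ∀ t ∈ Finset.Icc 1 T,
      3 * η * (quarterScale t * gradientChange η L0 L1 t (ρ t)) ≤
      stepSize η t * ρ t / 2 + 3 * η ^ 2 * L0 * (quarterScale t ^ 4 +
        (Real.exp a - 1) * quarterScale t ^ 7) +
      3 * η * (Real.exp a - 1) * R *
        (if 1 / 7 < a * quarterScale t then quarterScale t ^ 4 else 0) := by
    intro t ht
    have ht1 := (Finset.mem_Icc.1 ht).1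
    have hq := quarterScale_pos ht1
    have hq1 := quarterScale_le_one ht1
    have hr0 := hρ0 t ht1
    have hr := hρ t ht1
    have hc : L1 * stepSize η t = a * quarterScale t ^ 3 := by rw [stepSize_eq, ha_def]; ring
    unfold gradientChange
    rw [hc, stepSize_eq]
    set q := quarterScale t
    have hq3 : q ^ 3 ≤ 1 := pow_le_one₀ hq.le hq1
    have hconv := exp_mul_sub_one_le a (s := q ^ 3) (by positivity) hq3
    have hL : 3 * η * (q * (Real.exp (a * q ^ 3) * L0 * (η * q ^ 3))) ≤
        3 * η ^ 2 * L0 * (q ^ 4 + (Real.exp a - 1) * q ^ 7) := by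
      have : 3 * η ^ 2 * L0 * q ^ 4 * Real.exp (a * q ^ 3) ≤
        3 * η ^ 2 * L0 * q ^ 4 * (1 + q ^ 3 * (Real.exp a - 1)) := by
        gcongr; linarith
      calc _ = 3 * η ^ 2 * L0 * q ^ 4 * Real.exp (a * q ^ 3) := by ring
        _ ≤ _ := this
        _ = _ := by ring
    have hP : 3 * η * (q * ((Real.exp (a * q ^ 3) - 1) * ρ t)) ≤ η * q ^ 3 * ρ t / 2 +
        3 * η * (Real.exp a - 1) * R * (if 1 / 7 < a * q then q ^ 4 else 0) := by
      split_ifs with h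
      · have hinv : 1 / q ≤ 7 * a := by rw [div_le_iff₀ hq]; linarith
        have hinv1 : 1 ≤ 1 / q := by rw [le_div_iff₀ hq]; linarith
        have hρR : ρ t ≤ R := by
          refine hr.trans ?_
          have h4 : 4 / q = 4 * (1 / q) := by ring
          have e1 : L1 * (η * (4 / q - 3)) ≤ 28 * a ^ 2 - 3 * a := by
            have : L1 * (η * (4 / q - 3)) = a * (4 * (1 / q) - 3) := by rw [ha_def]; ring
            rw [this]; nlinarith
          have e2 : L0 * (η * (4 / q - 3)) ≤ 28 * η * a * L0 := by
            have : L0 * (η * (4 / q - 3)) ≤ L0 * (η * (28 * a)) := by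
              gcongr; linarith
            linarith
          have e3 : 0 ≤ L0 * (η * (4 / q - 3)) := by
            have : 0 ≤ 4 / q - 3 := by linarith
            positivity
          rw [hR]
          gcongr
        have : 3 * η * (q * ((Real.exp (a * q ^ 3) - 1) * ρ t)) ≤
            3 * η * (q * ((q ^ 3 * (Real.exp a - 1)) * R)) := by gcongr
        have h2 : 0 ≤ η * q ^ 3 * ρ t / 2 := by positivity
        linarith
      · push Not at h
        have hc7 : a * q ^ 3 ≤ 1 / 7 := by
          have : q ^ 3 ≤ q := pow_le_of_le_one hq.le hq1 (by norm_num)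
          nlinarith
        have := exp_sub_one_le_of_le_inv_seven hc7 (by positivity)
        -- The threshold 1/7 is chosen so that 3 · (7/6) · (1/7) = 1/2, the share that can be
        -- absorbed.
        calc 3 * η * (q * ((Real.exp (a * q ^ 3) - 1) * ρ t))
            ≤ 3 * η * (q * ((7 / 6 * (a * q ^ 3)) * ρ t)) := by gcongr
          _ = 7 / 2 * (η * q ^ 3 * ρ t) * (a * q) := by ring
          _ ≤ 7 / 2 * (η * q ^ 3 * ρ t) * (1 / 7) := by gcongr
          _ = _ := by ring
    linarith
  refine (Finset.sum_le_sum hterm).trans ?_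
  rw [Finset.sum_add_distrib, Finset.sum_add_distrib, ← Finset.sum_div, ← Finset.mul_sum,
    ← Finset.mul_sum, Finset.sum_add_distrib, ← Finset.mul_sum]
  have s4 := sum_quarterScale_pow_four_le T
  have s7 : ∑ t ∈ Finset.Icc 1 T, quarterScale t ^ 7 ≤ 3 := by
    have := sum_quarterScale_pow_seven_le hT
    linarith [sq_nonneg (quarterScale T)]
  have sl := sum_large_step_le ha T
  have b1 : 3 * η ^ 2 * L0 * (∑ t ∈ Finset.Icc 1 T, quarterScale t ^ 4 +
      (Real.exp a - 1) * ∑ t ∈ Finset.Icc 1 T, quarterScale t ^ 7) ≤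
      3 * η ^ 2 * L0 * (1 + Real.log T + 3 * (Real.exp a - 1)) := by
    rw [mul_comm (3 : ℝ) (Real.exp a - 1)]
    gcongr
  have b2 : 3 * η * (Real.exp a - 1) * R *
      ∑ t ∈ Finset.Icc 1 T, (if 1 / 7 < a * quarterScale t then quarterScale t ^ 4 else 0) ≤
      84 * η * a ^ 2 * Real.exp (28 * a ^ 2) * (G + 28 * η * a * L0) := by
    have hx : (Real.exp a - 1) * Real.exp (28 * a ^ 2 - 3 * a) ≤
        a * Real.exp (28 * a ^ 2) := by
      calc _ ≤ a * Real.exp a * Real.exp (28 * a ^ 2 - 3 * a) := by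
            gcongr; exact exp_sub_one_le_mul_exp a
        _ = a * Real.exp (a + (28 * a ^ 2 - 3 * a)) := by rw [Real.exp_add]; ring
        _ ≤ _ := by gcongr; linarith
    calc _ ≤ 3 * η * (Real.exp a - 1) * R * (28 * a) := by gcongr
      _ = 84 * η * a * (G + 28 * η * a * L0) *
          ((Real.exp a - 1) * Real.exp (28 * a ^ 2 - 3 * a)) := by rw [hR]; ring
      _ ≤ 84 * η * a * (G + 28 * η * a * L0) * (a * Real.exp (28 * a ^ 2)) := by gcongr
      _ = _ := by ring
  linarith

/-! ### Comparison of constants -/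

lemma one_le_expQuot {a : ℝ} (ha : 0 ≤ a) : 1 ≤ expQuot a := by
  unfold expQuot
  split_ifs with h
  · rfl
  · rw [le_div_iff₀ (lt_of_le_of_ne ha (Ne.symm h))]; linarith [Real.add_one_le_exp a]

lemma mul_expQuot (a : ℝ) : a * expQuot a = Real.exp a - 1 := by
  unfold expQuot
  split_ifs with h
  · simp [h]
  · field_simp

/-- For a ≤ 4 the left side is 9 a `expQuot a`, at most 36 `expQuot a`; for a ≥ 4 the Gaussian
exponential dominates, as 48 a^2 ≥ 8 + a and exp 8 ≥ 9. -/
lemma nine_mul_exp_sub_one_le {a : ℝ} (ha : 0 ≤ a) :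
    9 * (Real.exp a - 1) ≤ 42 * expQuot a + Real.exp (48 * a ^ 2) := by
  have h1 := one_le_expQuot ha
  rcases le_total a 4 with h | h
  · rw [← mul_expQuot]
    nlinarith [Real.exp_pos (48 * a ^ 2)]
  · have h2 : Real.exp (8 + a) ≤ Real.exp (48 * a ^ 2) := by gcongr; nlinarith
    have h3 := Real.add_one_le_exp (8 : ℝ)
    rw [Real.exp_add] at h2
    nlinarith [Real.exp_pos a]

lemma exp_forty_eight_mul (a : ℝ) :
    Real.exp (48 * a ^ 2) = Real.exp (28 * a ^ 2) * Real.exp (20 * a ^ 2) := by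
  rw [← Real.exp_add]; ring_nf

lemma initial_gradient_const_le (a : ℝ) :
    84 * a ^ 2 * Real.exp (28 * a ^ 2) ≤ 6 * Real.exp (48 * a ^ 2) := by
  rw [exp_forty_eight_mul]
  have := Real.add_one_le_exp (20 * a ^ 2)
  nlinarith [Real.exp_pos (28 * a ^ 2), sq_nonneg a,
    mul_le_mul_of_nonneg_left this (Real.exp_pos (28 * a ^ 2)).le]

lemma initial_gradient_const_le' {a : ℝ} (ha : 1 / 2 ≤ a) :
    84 * a ^ 2 * Real.exp (28 * a ^ 2) ≤ Real.exp (48 * a ^ 2) / a := by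
  have ha0 : 0 < a := by linarith
  rw [exp_forty_eight_mul, le_div_iff₀ ha0]
  have h := Real.quadratic_le_exp_of_nonneg (x := 20 * a ^ 2) (by positivity)
  have h2 : 84 * a ^ 3 ≤ Real.exp (20 * a ^ 2) := by
    have : 0 ≤ a ^ 3 * (200 * a - 84) := mul_nonneg (by positivity) (by linarith)
    nlinarith [sq_nonneg a]
  nlinarith [mul_le_mul_of_nonneg_left h2 (Real.exp_pos (28 * a ^ 2)).le]

lemma initial_smoothness_const_le {a : ℝ} :
    84 * a ^ 2 * Real.exp (28 * a ^ 2) * (28 * a) ≤ 20 * Real.exp (48 * a ^ 2) := by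
  rw [exp_forty_eight_mul]
  have h := Real.quadratic_le_exp_of_nonneg (x := 20 * a ^ 2) (by positivity)
  have h2 : 84 * a ^ 2 * (28 * a) ≤ 20 * Real.exp (20 * a ^ 2) := by
    have : 0 ≤ a ^ 2 * (4000 * a ^ 2 - 2352 * a + 400) :=
      mul_nonneg (sq_nonneg a) (by nlinarith [sq_nonneg (4000 * a - 1176)])
    nlinarith
  nlinarith [mul_le_mul_of_nonneg_left h2 (Real.exp_pos (28 * a ^ 2)).le]

/-! ### The trajectory -/

section Trajectory

variable {d : ℕ} {S : Type*} {F : EuclideanSpace ℝ (Fin d) → ℝ}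
  {g : EuclideanSpace ℝ (Fin d) → S → EuclideanSpace ℝ (Fin d)}

/-- The exponentially averaged noise of the stochastic gradients along a trajectory. -/
noncomputable def nsgdmNoise (η β : ℕ → ℝ) (F : EuclideanSpace ℝ (Fin d) → ℝ)
    (g : EuclideanSpace ℝ (Fin d) → S → EuclideanSpace ℝ (Fin d))
    (x₁ : EuclideanSpace ℝ (Fin d)) (ξ : ℕ → S) : ℕ → EuclideanSpace ℝ (Fin d)
  | 0 => 0
  | t + 1 => β (t + 1) • nsgdmNoise η β F g x₁ ξ t + (1 - β (t + 1)) •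
      (g (nsgdmState η β g x₁ ξ t).1 (ξ (t + 1)) - gradient F (nsgdmState η β g x₁ ξ t).1)

lemma nsgdmState_succ_fst (η β : ℕ → ℝ) (x₁ : EuclideanSpace ℝ (Fin d)) (ξ : ℕ → S) (t : ℕ) :
    (nsgdmState η β g x₁ ξ (t + 1)).1 = (nsgdmState η β g x₁ ξ t).1 - η (t + 1) •
      (‖(nsgdmState η β g x₁ ξ (t + 1)).2‖⁻¹ • (nsgdmState η β g x₁ ξ (t + 1)).2) := rfl

lemma nsgdmState_succ_snd (η β : ℕ → ℝ) (x₁ : EuclideanSpace ℝ (Fin d)) (ξ : ℕ → S) (t : ℕ) :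
    (nsgdmState η β g x₁ ξ (t + 1)).2 = β (t + 1) • (nsgdmState η β g x₁ ξ t).2 +
      (1 - β (t + 1)) • g (nsgdmState η β g x₁ ξ t).1 (ξ (t + 1)) := rfl

lemma norm_nsgdmState_step_le {η β : ℕ → ℝ} (x₁ : EuclideanSpace ℝ (Fin d)) (ξ : ℕ → S) (t : ℕ)
    (hη : 0 ≤ η (t + 1)) :
    ‖(nsgdmState η β g x₁ ξ (t + 1)).1 - (nsgdmState η β g x₁ ξ t).1‖ ≤ η (t + 1) := by
  rw [nsgdmState_succ_fst, sub_sub_cancel_left, norm_neg, norm_smul, norm_smul, norm_inv,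
    norm_norm, Real.norm_of_nonneg hη]
  exact mul_le_of_le_one_right hη inv_mul_le_one

lemma norm_nsgdmState_sub_le {η β : ℕ → ℝ} (hη : ∀ t, 0 ≤ η t) (x₁ : EuclideanSpace ℝ (Fin d))
    (ξ : ℕ → S) (t : ℕ) :
    ‖(nsgdmState η β g x₁ ξ t).1 - x₁‖ ≤ ∑ s ∈ Finset.Icc 1 t, η s := by
  induction t with
  | zero => simp [nsgdmState]
  | succ t ih =>
    rw [Finset.sum_Icc_succ_top (by omega)]
    have := norm_nsgdmState_step_le (β := β) (g := g) x₁ ξ t (hη _)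
    have h2 := norm_sub_le_norm_sub_add_norm_sub (nsgdmState η β g x₁ ξ (t + 1)).1
      (nsgdmState η β g x₁ ξ t).1 x₁
    linarith

/-- Normalization makes the distance from x_1 at most the sum of the step sizes, whatever the
samples. The resulting deterministic bound serves both the initial phase and integrability. -/
lemma norm_gradient_nsgdmState_le {L0 L1 η : ℝ} (h : IsL0L1Smooth L0 L1 F) (hη : 0 < η)
    (hL0 : 0 ≤ L0) (hL1 : 0 ≤ L1) (β : ℕ → ℝ) (x₁ : EuclideanSpace ℝ (Fin d)) (ξ : ℕ → S)
    {t : ℕ} (ht : 1 ≤ t) :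
    ‖gradient F (nsgdmState (stepSize η) β g x₁ ξ (t - 1)).1‖ ≤
      Real.exp (L1 * (η * (4 / quarterScale t - 3))) *
        (‖gradient F x₁‖ + L0 * (η * (4 / quarterScale t - 3))) := by
  refine h.norm_gradient_le hL0 hL1 ?_
  refine (norm_nsgdmState_sub_le (stepSize_nonneg hη) x₁ ξ _).trans ?_
  have h1 := sum_quarterScale_pow_three_le ht
  have h2 : ∑ s ∈ Finset.Icc 1 (t - 1), stepSize η s ≤ ∑ s ∈ Finset.Icc 1 t, stepSize η s :=
    Finset.sum_le_sum_of_subset_of_nonneg (Finset.Icc_subset_Icc_right (by omega))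
      fun s _ _ => stepSize_nonneg hη s
  refine h2.trans ?_
  simp only [stepSize_eq, ← Finset.mul_sum]
  gcongr

/-- The fresh sample enters the momentum and the averaged noise with the same weight, so it cancels
in their difference. -/
lemma nsgdm_drift_step (η β : ℕ → ℝ) (x₁ : EuclideanSpace ℝ (Fin d)) (ξ : ℕ → S) (t : ℕ) :
    (nsgdmState η β g x₁ ξ (t + 1)).2 - gradient F (nsgdmState η β g x₁ ξ t).1
        - nsgdmNoise η β F g x₁ ξ (t + 1) =
      β (t + 1) • ((nsgdmState η β g x₁ ξ t).2 - gradient F (nsgdmState η β g x₁ ξ t).1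
        - nsgdmNoise η β F g x₁ ξ t) := by
  rw [nsgdmState_succ_snd, nsgdmNoise]
  module

/-- The deterministic part of the analysis, valid along every trajectory. -/
lemma nsgdm_pathwise_bound {L0 L1 η : ℝ} (h : IsL0L1Smooth L0 L1 F) (hη : 0 < η)
    (hL0 : 0 ≤ L0) (hL1 : 0 ≤ L1) (hbdd : BddBelow (Set.range F))
    (x₁ : EuclideanSpace ℝ (Fin d)) (ξ : ℕ → S) {T : ℕ} (hT : 1 ≤ T) :
    ∑ t ∈ Finset.Icc 1 T, stepSize η t / 2 *
        ‖gradient F (nsgdmState (stepSize η) momentumParam g x₁ ξ (t - 1)).1‖ ≤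
      (F x₁ - ⨅ y, F y) + 2 * ∑ t ∈ Finset.Icc 1 T, stepSize η t *
        ‖nsgdmNoise (stepSize η) momentumParam F g x₁ ξ t‖ +
      3 * η ^ 2 * L0 * (1 + Real.log T + 3 * (Real.exp (η * L1) - 1)) +
      84 * η * (η * L1) ^ 2 * Real.exp (28 * (η * L1) ^ 2) *
        (‖gradient F x₁‖ + 28 * η * (η * L1) * L0) := by
  -- Index shift: X t is x_{t+1} while M t is m_t, so the gradient belonging to time t is taken at X
  -- (t - 1).
  set X : ℕ → EuclideanSpace ℝ (Fin d) :=
    fun t => (nsgdmState (stepSize η) momentumParam g x₁ ξ t).1 with hX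
  set M : ℕ → EuclideanSpace ℝ (Fin d) :=
    fun t => (nsgdmState (stepSize η) momentumParam g x₁ ξ t).2 with hM
  set N := nsgdmNoise (stepSize η) momentumParam F g x₁ ξ with hN
  set ρ : ℕ → ℝ := fun t => ‖gradient F (X (t - 1))‖ with hρ
  set b : ℕ → ℝ := fun t => gradientChange η L0 L1 t (ρ t) with hb
  have hstep : ∀ t, ‖X (t + 1) - X t‖ ≤ stepSize η (t + 1) := fun t =>
    norm_nsgdmState_step_le x₁ ξ t (stepSize_nonneg hη _)
  have hsum := sum_stepSize_mul_le hη (f := fun t => F (X (t - 1))) (ρ := ρ)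
    (ν := fun t => ‖N t‖) (δ := fun t => ‖M t - gradient F (X (t - 1)) - N t‖) (b := b)
    (fun t _ => gradientChange_nonneg hη hL0 hL1 t (norm_nonneg _))
    (fun t _ => norm_nonneg _)
    (by
      -- Since β_1 = 0, the initialization m_0 = 0 leaves no bias and the drift starts at zero.
      have := nsgdm_drift_step (F := F) (g := g) (stepSize η) momentumParam x₁ ξ 0
      simpa [momentumParam] using this)
    (by
      intro t ht
      obtain ⟨s, rfl⟩ := Nat.exists_eq_add_of_le' ht
      have hds := nsgdm_drift_step (F := F) (g := g) (stepSize η) momentumParam x₁ ξ (s + 1)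
      have hβ : 0 ≤ 1 - quarterScale (s + 1 + 1) ^ 2 := by
        have := pow_le_one₀ (n := 2) (quarterScale_nonneg (s + 1 + 1))
          (quarterScale_le_one (by omega))
        linarith
      have hch := h.norm_gradient_sub_le hL0 hL1 (x := X s) (y := X (s + 1))
        (r := stepSize η (s + 1)) (by rw [norm_sub_rev]; exact hstep s)
      change ‖M (s + 1 + 1) - gradient F (X (s + 1)) - N (s + 1 + 1)‖ ≤
        (1 - quarterScale (s + 1 + 1) ^ 2) * (‖M (s + 1) - gradient F (X s) - N (s + 1)‖ + b (s + 1))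
      change M (s + 1 + 1) - gradient F (X (s + 1)) - N (s + 1 + 1) = momentumParam (s + 1 + 1) •
        (M (s + 1) - gradient F (X (s + 1)) - N (s + 1)) at hds
      rw [hds, norm_smul, momentumParam_eq, Real.norm_of_nonneg hβ]
      gcongr
      have : M (s + 1) - gradient F (X (s + 1)) - N (s + 1) =
        (M (s + 1) - gradient F (X s) - N (s + 1)) +
          (gradient F (X s) - gradient F (X (s + 1))) := by abel
      rw [this]
      exact (norm_add_le _ _).trans (by gcongr; exact hch))
    (by
      intro t ht
      obtain ⟨s, rfl⟩ := Nat.exists_eq_add_of_le' ht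
      have hd := h.le_add_inner hL0 hL1 (hstep s)
      have hin := inner_normalized_ge (gradient F (X s)) (M (s + 1))
      have hx : X (s + 1) - X s = -(stepSize η (s + 1) • (‖M (s + 1)‖⁻¹ • M (s + 1))) := by
        simp only [hX, hM]
        rw [nsgdmState_succ_fst, sub_sub_cancel_left]
      have htri : ‖M (s + 1) - gradient F (X s)‖ ≤
          ‖N (s + 1)‖ + ‖M (s + 1) - gradient F (X s) - N (s + 1)‖ := by
        have := norm_add_le (N (s + 1)) (M (s + 1) - gradient F (X s) - N (s + 1))
        rwa [add_sub_cancel] at this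
      rw [hx, inner_neg_right, real_inner_smul_right] at hd
      have hη' := stepSize_nonneg hη (s + 1)
      have h2 : stepSize η (s + 1) * (‖gradient F (X s)‖ - 2 *
          (‖N (s + 1)‖ + ‖M (s + 1) - gradient F (X s) - N (s + 1)‖)) ≤ stepSize η (s + 1) *
          inner ℝ (gradient F (X s)) (‖M (s + 1)‖⁻¹ • M (s + 1)) := by
        gcongr; linarith
      simp only [hb, hρ, gradientChange, Nat.add_sub_cancel]
      linarith)
    hT
  have hch := sum_gradientChange_le hη hL0 hL1 (norm_nonneg (gradient F x₁)) (ρ := ρ)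
    (fun t _ => norm_nonneg _)
    (fun t ht => norm_gradient_nsgdmState_le h hη hL0 hL1 momentumParam x₁ ξ ht) hT
  have hinf : ⨅ y, F y ≤ F (X T) := ciInf_le hbdd _
  have hX0 : X 0 = x₁ := rfl
  simp only [Nat.sub_self, hX0, Nat.add_sub_cancel] at hsum
  have e : ∑ t ∈ Finset.Icc 1 T, stepSize η t / 2 * ρ t =
      (∑ t ∈ Finset.Icc 1 T, stepSize η t * ρ t) / 2 := by
    rw [Finset.sum_div]; exact Finset.sum_congr rfl fun _ _ => by ring
  change ∑ t ∈ Finset.Icc 1 T, stepSize η t / 2 * ρ t ≤ _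
  rw [e]
  linarith

/-- Only samples 1, ..., t are read; this lets the past be written as a function of finitely many
coordinates when proving independence. -/
lemma nsgdmState_congr (η β : ℕ → ℝ) (x₁ : EuclideanSpace ℝ (Fin d)) {ξ ζ : ℕ → S} {t : ℕ}
    (h : ∀ s < t, ξ (s + 1) = ζ (s + 1)) :
    nsgdmState η β g x₁ ξ t = nsgdmState η β g x₁ ζ t := by
  induction t with
  | zero => rfl
  | succ t ih =>
    simp only [nsgdmState, ih fun s hs => h s (by omega), h t (by omega)]

lemma nsgdmNoise_congr (η β : ℕ → ℝ) (x₁ : EuclideanSpace ℝ (Fin d)) {ξ ζ : ℕ → S} {t : ℕ}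
    (h : ∀ s < t, ξ (s + 1) = ζ (s + 1)) :
    nsgdmNoise η β F g x₁ ξ t = nsgdmNoise η β F g x₁ ζ t := by
  induction t with
  | zero => rfl
  | succ t ih =>
    simp only [nsgdmNoise, ih fun s hs => h s (by omega), h t (by omega),
      nsgdmState_congr η β x₁ fun s hs => h s (Nat.lt_succ_of_lt hs)]

end Trajectory

/-! ### The noise -/

section Noise

variable {d : ℕ} {Ω S : Type*} [MeasurableSpace Ω] [MeasurableSpace S]
  {F : EuclideanSpace ℝ (Fin d) → ℝ}
  {g : EuclideanSpace ℝ (Fin d) → S → EuclideanSpace ℝ (Fin d)}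

lemma measurable_gradient (F : EuclideanSpace ℝ (Fin d) → ℝ) : Measurable (gradient F) :=
  (InnerProductSpace.toDual ℝ (EuclideanSpace ℝ (Fin d))).symm.continuous.measurable.comp
    (measurable_fderiv ℝ F)

lemma Measurable.smul_add_smul {A E : Type*} [MeasurableSpace A] [NormedAddCommGroup E]
    [NormedSpace ℝ E] [MeasurableSpace E] [BorelSpace E] [SecondCountableTopology E] {u v : A → E}
    (hu : Measurable u) (hv : Measurable v) (b c : ℝ) : Measurable fun a => b • u a + c • v a :=
  (hu.const_smul b).add (hv.const_smul c)

lemma measurable_nsgdmState (hg : Measurable (Function.uncurry g)) (η β : ℕ → ℝ)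
    (x₁ : EuclideanSpace ℝ (Fin d)) {A : Type*} [MeasurableSpace A] {ξ : A → ℕ → S} {t : ℕ}
    (hξ : ∀ s < t, Measurable fun a => ξ a (s + 1)) :
    Measurable fun a => nsgdmState η β g x₁ (ξ a) t := by
  induction t with
  | zero => exact measurable_const
  | succ t ih =>
    have ih := ih fun s hs => hξ s (by omega)
    have h1 : Measurable fun a => g (nsgdmState η β g x₁ (ξ a) t).1 (ξ a (t + 1)) :=
      hg.comp (ih.fst.prodMk (hξ t (by omega)))
    have h2 : Measurable fun a => (nsgdmState η β g x₁ (ξ a) (t + 1)).2 :=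
      ih.snd.smul_add_smul h1 (β (t + 1)) (1 - β (t + 1))
    have h3 : Measurable fun a => (nsgdmState η β g x₁ (ξ a) (t + 1)).1 :=
      ih.fst.sub ((h2.norm.inv.smul h2).const_smul (η (t + 1)))
    exact h3.prodMk h2

lemma measurable_nsgdmNoise (hg : Measurable (Function.uncurry g)) (η β : ℕ → ℝ)
    (x₁ : EuclideanSpace ℝ (Fin d)) {A : Type*} [MeasurableSpace A] {ξ : A → ℕ → S} {t : ℕ}
    (hξ : ∀ s < t, Measurable fun a => ξ a (s + 1)) :
    Measurable fun a => nsgdmNoise η β F g x₁ (ξ a) t := by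
  induction t with
  | zero => exact measurable_const
  | succ t ih =>
    have ih := ih fun s hs => hξ s (by omega)
    have hX := (measurable_nsgdmState hg η β x₁ fun s hs => hξ s (Nat.lt_succ_of_lt hs)).fst
    have h1 : Measurable fun a => g (nsgdmState η β g x₁ (ξ a) t).1 (ξ a (t + 1)) :=
      hg.comp (hX.prodMk (hξ t (by omega)))
    exact ih.smul_add_smul (h1.sub ((measurable_gradient F).comp hX))
      (β (t + 1)) (1 - β (t + 1))

/-- The past of the algorithm is independent of the next sample. -/
lemma indepFun_nsgdm_past {P : Measure Ω} [IsProbabilityMeasure P]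
    (hg : Measurable (Function.uncurry g)) {ξ : ℕ → Ω → S}
    (hξ_meas : ∀ t : ℕ, 1 ≤ t → Measurable (ξ t))
    (hξ_indep : iIndepFun (fun t : ℕ => ξ (t + 1)) P) (η β : ℕ → ℝ)
    (x₁ : EuclideanSpace ℝ (Fin d)) (t : ℕ) :
    IndepFun (fun ω => ((nsgdmState η β g x₁ (fun s => ξ s ω) t).1,
      nsgdmNoise η β F g x₁ (fun s => ξ s ω) t)) (ξ (t + 1)) P := by
  have hΩ : Nonempty Ω := nonempty_of_isProbabilityMeasure P
  obtain ⟨ω₀⟩ := hΩ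
  have hind := hξ_indep.indepFun_finset (Finset.range t) {t} (by simp)
    fun i => hξ_meas (i + 1) (by omega)
  -- The finite past is padded to a full sequence by an arbitrary point of S, which is never read.
  -- Coordinate i of the past holds sample i + 1.
  let ext : (Finset.range t → S) → ℕ → S := fun v s =>
    if h : s - 1 ∈ Finset.range t then v ⟨s - 1, h⟩ else ξ 0 ω₀
  have hext : ∀ s < t, Measurable fun v => ext v (s + 1) := by
    intro s hs
    have h : s + 1 - 1 ∈ Finset.range t := by simpa using hs
    simp only [ext, dif_pos h]
    exact measurable_pi_apply _
  have hφ : Measurable fun v => ((nsgdmState η β g x₁ (ext v) t).1,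
      nsgdmNoise η β F g x₁ (ext v) t) :=
    (measurable_nsgdmState hg η β x₁ hext).fst.prodMk (measurable_nsgdmNoise hg η β x₁ hext)
  have hψ : Measurable fun v : ({t} : Finset ℕ) → S => v ⟨t, by simp⟩ := measurable_pi_apply _
  have := hind.comp hφ hψ
  refine this.congr (Filter.Eventually.of_forall fun ω => ?_) Filter.EventuallyEq.rfl
  have hagree : ∀ s < t, (fun s => ξ s ω) (s + 1) =
      ext (fun i : Finset.range t => ξ (i + 1) ω) (s + 1) := by
    intro s hs
    have h : s + 1 - 1 ∈ Finset.range t := by simpa using hs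
    simp only [ext, dif_pos h, Nat.add_sub_cancel]
  simp only [Function.comp]
  rw [← nsgdmState_congr (ξ := fun s => ξ s ω) η β x₁ hagree,
    ← nsgdmNoise_congr (ξ := fun s => ξ s ω) η β x₁ hagree]

/-- One-step second moment estimate with a frozen past. -/
lemma lintegral_norm_sq_add_noise_le {D : Measure S} [IsProbabilityMeasure D] {σ : ℝ}
    (hgrad : IsStochasticGradient D F g σ) (β : ℝ) (x N : EuclideanSpace ℝ (Fin d)) :
    ∫⁻ s, ENNReal.ofReal (‖β • N + (1 - β) • (g x s - gradient F x)‖ ^ 2) ∂D ≤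
      ENNReal.ofReal (β ^ 2 * ‖N‖ ^ 2 + (1 - β) ^ 2 * σ ^ 2) := by
  have hγ : Integrable (fun s => g x s - gradient F x) D :=
    (hgrad.integrable x).sub (integrable_const _)
  have hmean : ∫ s, (g x s - gradient F x) ∂D = 0 := by
    rw [integral_sub (hgrad.integrable x) (integrable_const _), hgrad.unbiased]; simp
  have hin : Integrable (fun s => inner ℝ N (g x s - gradient F x)) D := hγ.const_inner N
  have hexp : (fun s => ‖β • N + (1 - β) • (g x s - gradient F x)‖ ^ 2) = fun s =>
      β ^ 2 * ‖N‖ ^ 2 + 2 * β * (1 - β) * inner ℝ N (g x s - gradient F x) +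
        (1 - β) ^ 2 * ‖g x s - gradient F x‖ ^ 2 := by
    funext s
    rw [norm_add_sq_real, norm_smul, norm_smul, real_inner_smul_left, real_inner_smul_right,
      mul_pow, mul_pow, Real.norm_eq_abs, Real.norm_eq_abs, sq_abs, sq_abs]
    ring
  have hi1 : Integrable (fun s => β ^ 2 * ‖N‖ ^ 2 +
      2 * β * (1 - β) * inner ℝ N (g x s - gradient F x)) D :=
    (integrable_const _).add (hin.const_mul _)
  have hi2 := (hgrad.sq_integrable x).const_mul ((1 - β) ^ 2)
  have hint : Integrable (fun s => ‖β • N + (1 - β) • (g x s - gradient F x)‖ ^ 2) D := by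
    rw [hexp]; exact hi1.add hi2
  rw [← ofReal_integral_eq_lintegral_ofReal hint (Filter.Eventually.of_forall fun s => sq_nonneg _)]
  refine ENNReal.ofReal_le_ofReal ?_
  rw [hexp, integral_add hi1 hi2, integral_add (integrable_const _) (hin.const_mul _),
    integral_const_mul, integral_const_mul, integral_const_mul, integral_inner hγ, hmean]
  simp only [integral_const, inner_zero_right, mul_zero, add_zero, probReal_univ, one_smul]
  gcongr
  exact hgrad.variance_le x

variable {P : Measure Ω} [IsProbabilityMeasure P] {D : Measure S} [IsProbabilityMeasure D]
  {σ : ℝ} {ξ : ℕ → Ω → S}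

/-- One-step second moment estimate for a past `(X, N)` independent of the next sample. -/
lemma lintegral_norm_sq_add_noise_le_of_indepFun (hgrad : IsStochasticGradient D F g σ)
    {X N : Ω → EuclideanSpace ℝ (Fin d)} {ζ : Ω → S} (hX : Measurable X) (hN : Measurable N)
    (hζ : Measurable ζ) (hlaw : P.map ζ = D) (hind : IndepFun (fun ω => (X ω, N ω)) ζ P) (β : ℝ) :
    ∫⁻ ω, ENNReal.ofReal (‖β • N ω + (1 - β) • (g (X ω) (ζ ω) - gradient F (X ω))‖ ^ 2) ∂P ≤
      ENNReal.ofReal (β ^ 2) * ∫⁻ ω, ENNReal.ofReal (‖N ω‖ ^ 2) ∂P +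
      ENNReal.ofReal ((1 - β) ^ 2 * σ ^ 2) := by
  have hZm : Measurable fun ω => (X ω, N ω) := hX.prodMk hN
  have hmap : P.map (fun ω => ((X ω, N ω), ζ ω)) = (P.map fun ω => (X ω, N ω)).prod D := by
    rw [(indepFun_iff_map_prod_eq_prod_map_map hZm.aemeasurable hζ.aemeasurable).1 hind, hlaw]
  have hf : Measurable fun p : (EuclideanSpace ℝ (Fin d) × EuclideanSpace ℝ (Fin d)) × S =>
      ENNReal.ofReal (‖β • p.1.2 + (1 - β) • (g p.1.1 p.2 - gradient F p.1.1)‖ ^ 2) := by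
    have h1 : Measurable fun p : (EuclideanSpace ℝ (Fin d) × EuclideanSpace ℝ (Fin d)) × S =>
        g p.1.1 p.2 := hgrad.measurable.comp (measurable_fst.fst.prodMk measurable_snd)
    have h2 : Measurable fun p : (EuclideanSpace ℝ (Fin d) × EuclideanSpace ℝ (Fin d)) × S =>
        gradient F p.1.1 := (measurable_gradient F).comp measurable_fst.fst
    have h3 : Measurable fun p : (EuclideanSpace ℝ (Fin d) × EuclideanSpace ℝ (Fin d)) × S =>
        p.1.2 := measurable_fst.snd
    exact ((h3.smul_add_smul (h1.sub h2) β (1 - β)).norm.pow_const 2).ennreal_ofReal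
  have hb : Measurable fun z : EuclideanSpace ℝ (Fin d) × EuclideanSpace ℝ (Fin d) =>
      ENNReal.ofReal (β ^ 2 * ‖z.2‖ ^ 2 + (1 - β) ^ 2 * σ ^ 2) :=
    (((measurable_snd.norm.pow_const 2).const_mul _).add_const _).ennreal_ofReal
  -- Under the product law Tonelli freezes the past and integrates the new sample first.
  rw [← lintegral_map hf (hZm.prodMk hζ), hmap, lintegral_prod _ hf.aemeasurable]
  have hinner (z : EuclideanSpace ℝ (Fin d) × EuclideanSpace ℝ (Fin d)) :=
    lintegral_norm_sq_add_noise_le hgrad β z.1 z.2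
  have hsplit (ω : Ω) : ENNReal.ofReal (β ^ 2 * ‖N ω‖ ^ 2 + (1 - β) ^ 2 * σ ^ 2) =
      ENNReal.ofReal (β ^ 2) * ENNReal.ofReal (‖N ω‖ ^ 2) +
        ENNReal.ofReal ((1 - β) ^ 2 * σ ^ 2) := by
    rw [ENNReal.ofReal_add (by positivity) (by positivity), ENNReal.ofReal_mul (sq_nonneg _)]
  calc _ ≤ ∫⁻ z, ENNReal.ofReal (β ^ 2 * ‖z.2‖ ^ 2 + (1 - β) ^ 2 * σ ^ 2)
        ∂(P.map fun ω => (X ω, N ω)) := lintegral_mono hinner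
    _ = ∫⁻ ω, ENNReal.ofReal (β ^ 2 * ‖N ω‖ ^ 2 + (1 - β) ^ 2 * σ ^ 2) ∂P :=
        lintegral_map hb hZm
    _ = ∫⁻ ω, (ENNReal.ofReal (β ^ 2) * ENNReal.ofReal (‖N ω‖ ^ 2) +
        ENNReal.ofReal ((1 - β) ^ 2 * σ ^ 2)) ∂P := lintegral_congr hsplit
    _ = _ := by
        rw [lintegral_add_right _ measurable_const,
          lintegral_const_mul' _ _ ENNReal.ofReal_ne_top, lintegral_const, measure_univ, mul_one]

/-- The lower integral needs no prior integrability; finiteness of the second moments comes out of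
the recursion itself. -/
lemma lintegral_nsgdmNoise_sq_succ_le (hgrad : IsStochasticGradient D F g σ)
    (hξ_meas : ∀ t : ℕ, 1 ≤ t → Measurable (ξ t))
    (hξ_law : ∀ t : ℕ, 1 ≤ t → P.map (ξ t) = D)
    (hξ_indep : iIndepFun (fun t : ℕ => ξ (t + 1)) P) (η β : ℕ → ℝ)
    (x₁ : EuclideanSpace ℝ (Fin d)) (t : ℕ) :
    ∫⁻ ω, ENNReal.ofReal (‖nsgdmNoise η β F g x₁ (fun s => ξ s ω) (t + 1)‖ ^ 2) ∂P ≤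
      ENNReal.ofReal (β (t + 1) ^ 2) *
        ∫⁻ ω, ENNReal.ofReal (‖nsgdmNoise η β F g x₁ (fun s => ξ s ω) t‖ ^ 2) ∂P +
      ENNReal.ofReal ((1 - β (t + 1)) ^ 2 * σ ^ 2) := by
  have hm : ∀ s < t, Measurable fun ω => ξ (s + 1) ω := fun s _ => hξ_meas _ (by omega)
  have hX := (measurable_nsgdmState (ξ := fun ω s => ξ s ω) hgrad.measurable η β x₁ hm).fst
  have hN := measurable_nsgdmNoise (ξ := fun ω s => ξ s ω) (F := F) hgrad.measurable η β x₁ hm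
  simp only [nsgdmNoise]
  exact lintegral_norm_sq_add_noise_le_of_indepFun hgrad hX hN (hξ_meas (t + 1) (by omega))
    (hξ_law (t + 1) (by omega))
    (indepFun_nsgdm_past hgrad.measurable hξ_meas hξ_indep η β x₁ t) (β (t + 1))

lemma lintegral_nsgdmNoise_sq_le (hgrad : IsStochasticGradient D F g σ)
    (hξ_meas : ∀ t : ℕ, 1 ≤ t → Measurable (ξ t))
    (hξ_law : ∀ t : ℕ, 1 ≤ t → P.map (ξ t) = D)
    (hξ_indep : iIndepFun (fun t : ℕ => ξ (t + 1)) P) (η : ℕ → ℝ)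
    (x₁ : EuclideanSpace ℝ (Fin d)) {t : ℕ} (ht : 1 ≤ t) :
    ∫⁻ ω, ENNReal.ofReal (‖nsgdmNoise η momentumParam F g x₁ (fun s => ξ s ω) t‖ ^ 2) ∂P ≤
      ENNReal.ofReal (quarterScale t ^ 2 * σ ^ 2) := by
  induction t, ht using Nat.le_induction with
  | base =>
    refine (lintegral_nsgdmNoise_sq_succ_le hgrad hξ_meas hξ_law hξ_indep η _ x₁ 0).trans ?_
    simp [momentumParam_eq, quarterScale_one]
  | succ t ht ih =>
    refine (lintegral_nsgdmNoise_sq_succ_le hgrad hξ_meas hξ_law hξ_indep η _ x₁ t).trans ?_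
    refine (add_le_add (mul_le_mul_right ih _) le_rfl).trans ?_
    rw [← ENNReal.ofReal_mul (sq_nonneg _), ← ENNReal.ofReal_add (by positivity) (by positivity),
      momentumParam_eq]
    refine ENNReal.ofReal_le_ofReal ?_
    have := mul_le_mul_of_nonneg_right (variance_step ht) (sq_nonneg σ)
    linarith

lemma memLp_nsgdmNoise (hgrad : IsStochasticGradient D F g σ)
    (hξ_meas : ∀ t : ℕ, 1 ≤ t → Measurable (ξ t))
    (hξ_law : ∀ t : ℕ, 1 ≤ t → P.map (ξ t) = D)
    (hξ_indep : iIndepFun (fun t : ℕ => ξ (t + 1)) P) (η : ℕ → ℝ)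
    (x₁ : EuclideanSpace ℝ (Fin d)) {t : ℕ} (ht : 1 ≤ t) :
    MemLp (fun ω => ‖nsgdmNoise η momentumParam F g x₁ (fun s => ξ s ω) t‖) 2 P := by
  have hm : Measurable fun ω => ‖nsgdmNoise η momentumParam F g x₁ (fun s => ξ s ω) t‖ :=
    (measurable_nsgdmNoise hgrad.measurable η _ x₁ fun s _ => hξ_meas _ (by omega)).norm
  rw [memLp_two_iff_integrable_sq hm.aestronglyMeasurable]
  refine ⟨(hm.pow_const 2).aestronglyMeasurable, ?_⟩
  rw [hasFiniteIntegral_iff_ofReal (Filter.Eventually.of_forall fun _ => sq_nonneg _)]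
  exact (lintegral_nsgdmNoise_sq_le hgrad hξ_meas hξ_law hξ_indep η x₁ ht).trans_lt
    ENNReal.ofReal_lt_top

lemma integral_norm_nsgdmNoise_le (hgrad : IsStochasticGradient D F g σ) (hσ : 0 ≤ σ)
    (hξ_meas : ∀ t : ℕ, 1 ≤ t → Measurable (ξ t))
    (hξ_law : ∀ t : ℕ, 1 ≤ t → P.map (ξ t) = D)
    (hξ_indep : iIndepFun (fun t : ℕ => ξ (t + 1)) P) (η : ℕ → ℝ)
    (x₁ : EuclideanSpace ℝ (Fin d)) {t : ℕ} (ht : 1 ≤ t) :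
    ∫ ω, ‖nsgdmNoise η momentumParam F g x₁ (fun s => ξ s ω) t‖ ∂P ≤ quarterScale t * σ := by
  have hL := memLp_nsgdmNoise hgrad hξ_meas hξ_law hξ_indep η x₁ ht
  -- Nonnegativity of the variance of ‖N_t‖ serves as Jensen's inequality (E‖N_t‖)^2 ≤ E‖N_t‖^2.
  have hvar := variance_nonneg
    (fun ω => ‖nsgdmNoise η momentumParam F g x₁ (fun s => ξ s ω) t‖) P
  rw [variance_eq_sub hL] at hvar
  refine le_of_sq_le_sq ?_ (mul_nonneg (quarterScale_nonneg t) hσ)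
  have h2 : ∫ ω, ‖nsgdmNoise η momentumParam F g x₁ (fun s => ξ s ω) t‖ ^ 2 ∂P ≤
      quarterScale t ^ 2 * σ ^ 2 := by
    rw [← ENNReal.ofReal_le_ofReal_iff (by positivity), ofReal_integral_eq_lintegral_ofReal
      hL.integrable_sq (Filter.Eventually.of_forall fun _ => sq_nonneg _)]
    exact lintegral_nsgdmNoise_sq_le hgrad hξ_meas hξ_law hξ_indep η x₁ ht
  rw [mul_pow]
  simp only [Pi.pow_apply] at hvar
  linarith

lemma integrable_norm_gradient_nsgdmState {L0 L1 η : ℝ} (h : IsL0L1Smooth L0 L1 F) (hη : 0 < η)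
    (hL0 : 0 ≤ L0) (hL1 : 0 ≤ L1) (hg : Measurable (Function.uncurry g))
    (hξ_meas : ∀ t : ℕ, 1 ≤ t → Measurable (ξ t)) (β : ℕ → ℝ)
    (x₁ : EuclideanSpace ℝ (Fin d)) {t : ℕ} (ht : 1 ≤ t) :
    Integrable (fun ω => ‖gradient F
      (nsgdmState (stepSize η) β g x₁ (fun s => ξ s ω) (t - 1)).1‖) P := by
  have hm : Measurable fun ω => ‖gradient F
      (nsgdmState (stepSize η) β g x₁ (fun s => ξ s ω) (t - 1)).1‖ :=
    ((measurable_gradient F).comp (measurable_nsgdmState hg _ β x₁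
      fun s _ => hξ_meas _ (by omega)).fst).norm
  refine (integrable_const (Real.exp (L1 * (η * (4 / quarterScale t - 3))) *
    (‖gradient F x₁‖ + L0 * (η * (4 / quarterScale t - 3))))).mono' hm.aestronglyMeasurable
    (Filter.Eventually.of_forall fun ω => ?_)
  rw [norm_norm]
  exact norm_gradient_nsgdmState_le h hη hL0 hL1 β x₁ _ ht

/-- The bound in expectation, before comparison of the constants. -/
lemma nsgdm_expected_bound {L0 L1 η : ℝ} (h : IsL0L1Smooth L0 L1 F) (hη : 0 < η)
    (hL0 : 0 ≤ L0) (hL1 : 0 ≤ L1) (hσ : 0 ≤ σ) (hbdd : BddBelow (Set.range F))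
    (hgrad : IsStochasticGradient D F g σ)
    (hξ_meas : ∀ t : ℕ, 1 ≤ t → Measurable (ξ t))
    (hξ_law : ∀ t : ℕ, 1 ≤ t → P.map (ξ t) = D)
    (hξ_indep : iIndepFun (fun t : ℕ => ξ (t + 1)) P)
    (x₁ : EuclideanSpace ℝ (Fin d)) {T : ℕ} (hT : 1 ≤ T) :
    ∑ t ∈ Finset.Icc 1 T, stepSize η t / 2 * ∫ ω, ‖gradient F
        (nsgdmState (stepSize η) momentumParam g x₁ (fun s => ξ s ω) (t - 1)).1‖ ∂P ≤
      (F x₁ - ⨅ y, F y) + 2 * (η * σ * (1 + Real.log T)) +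
      3 * η ^ 2 * L0 * (1 + Real.log T + 3 * (Real.exp (η * L1) - 1)) +
      84 * η * (η * L1) ^ 2 * Real.exp (28 * (η * L1) ^ 2) *
        (‖gradient F x₁‖ + 28 * η * (η * L1) * L0) := by
  set K₁ := F x₁ - ⨅ y, F y
  set K₂ := 3 * η ^ 2 * L0 * (1 + Real.log T + 3 * (Real.exp (η * L1) - 1))
  set K₃ := 84 * η * (η * L1) ^ 2 * Real.exp (28 * (η * L1) ^ 2) *
        (‖gradient F x₁‖ + 28 * η * (η * L1) * L0)
  have hi : ∀ t ∈ Finset.Icc 1 T, Integrable (fun ω => stepSize η t / 2 * ‖gradient F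
      (nsgdmState (stepSize η) momentumParam g x₁ (fun s => ξ s ω) (t - 1)).1‖) P := fun t ht =>
    (integrable_norm_gradient_nsgdmState h hη hL0 hL1 hgrad.measurable hξ_meas _ x₁
      (Finset.mem_Icc.1 ht).1).const_mul _
  have hn : ∀ t ∈ Finset.Icc 1 T, Integrable (fun ω => stepSize η t *
      ‖nsgdmNoise (stepSize η) momentumParam F g x₁ (fun s => ξ s ω) t‖) P := fun t ht =>
    ((memLp_nsgdmNoise hgrad hξ_meas hξ_law hξ_indep _ x₁
      (Finset.mem_Icc.1 ht).1).integrable (by norm_num)).const_mul _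
  have hnoise : ∑ t ∈ Finset.Icc 1 T, stepSize η t *
      ∫ ω, ‖nsgdmNoise (stepSize η) momentumParam F g x₁ (fun s => ξ s ω) t‖ ∂P ≤
      η * σ * (1 + Real.log T) := by
    calc _ ≤ ∑ t ∈ Finset.Icc 1 T, η * σ * quarterScale t ^ 4 := by
          refine Finset.sum_le_sum fun t ht => ?_
          have := integral_norm_nsgdmNoise_le hgrad hσ hξ_meas hξ_law hξ_indep (stepSize η) x₁
            (Finset.mem_Icc.1 ht).1
          calc _ ≤ stepSize η t * (quarterScale t * σ) :=
                mul_le_mul_of_nonneg_left this (stepSize_nonneg hη t)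
            _ = _ := by rw [stepSize_eq]; ring
      _ ≤ _ := by
          rw [← Finset.mul_sum]
          gcongr
          exact sum_quarterScale_pow_four_le T
  have hmono := integral_mono (μ := P) (integrable_finsetSum _ hi)
    (((integrable_const K₁).add ((integrable_finsetSum _ hn).const_mul 2)).add
      (integrable_const (K₂ + K₃)))
    (fun ω => by
      have := nsgdm_pathwise_bound (g := g) h hη hL0 hL1 hbdd x₁ (fun s => ξ s ω) hT
      simp only [Pi.add_apply]
      linarith)
  rw [integral_finsetSum _ hi, integral_add'
    ((integrable_const K₁).add ((integrable_finsetSum _ hn).const_mul 2)) (integrable_const _),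
    integral_add' (integrable_const _) ((integrable_finsetSum _ hn).const_mul 2),
    integral_const_mul, integral_finsetSum _ hn] at hmono
  simp only [integral_const_mul, integral_const, probReal_univ, one_smul] at hmono
  linarith

end Noise

/-! ### Comparison with the stated constants -/

theorem mainTheorem1
    {d : ℕ} {Ω S : Type*} [MeasurableSpace Ω] [MeasurableSpace S]
    (P : Measure Ω) [IsProbabilityMeasure P] (D : Measure S) [IsProbabilityMeasure D]
    (F : EuclideanSpace ℝ (Fin d) → ℝ)
    (g : EuclideanSpace ℝ (Fin d) → S → EuclideanSpace ℝ (Fin d))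
    (L0 L1 σ η : ℝ) (hL0 : 0 ≤ L0) (hL1 : 0 ≤ L1) (hσ : 0 ≤ σ) (hη : 0 < η)
    (hbdd : BddBelow (Set.range F))
    (hsmooth : IsL0L1Smooth L0 L1 F)
    (hgrad : IsStochasticGradient D F g σ)
    (ξ : ℕ → Ω → S)
    (hξ_meas : ∀ t : ℕ, 1 ≤ t → Measurable (ξ t))
    (hξ_law : ∀ t : ℕ, 1 ≤ t → P.map (ξ t) = D)
    (hξ_indep : iIndepFun (fun t : ℕ => ξ (t + 1)) P)
    (x₁ : EuclideanSpace ℝ (Fin d))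
    (x : ℕ → Ω → EuclideanSpace ℝ (Fin d))
    (hx : ∀ t ω, x t ω =
      nsgdmIterate (stepSize η) momentumParam g x₁ (fun s => ξ s ω) t) :
    (∀ t : ℕ, 1 ≤ t → Integrable (fun ω => ‖gradient F (x t ω)‖) P) ∧
    ∀ T : ℕ, 1 ≤ T →
      (∑ t ∈ Finset.Icc 1 T, stepSize η t / 2 * ∫ ω, ‖gradient F (x t ω)‖ ∂P ≤
        (F x₁ - ⨅ y, F y)
          + η * σ * (7 + 2 * Real.sqrt (2 * Real.exp 1 ^ 2) * Real.log T)
          + η ^ 2 * L0 * (45 * expQuot (η * L1) + 14 * Real.log T)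
          + 21 * η ^ 2 * L0 * Real.exp (48 * (η * L1) ^ 2)
          + 6 * η * Real.exp (48 * (η * L1) ^ 2) * ‖gradient F x₁‖) ∧
      (1 / (2 * η) ≤ L1 →
        ∑ t ∈ Finset.Icc 1 T, stepSize η t / 2 * ∫ ω, ‖gradient F (x t ω)‖ ∂P ≤
          (F x₁ - ⨅ y, F y)
            + η * σ * (7 + 2 * Real.sqrt (2 * Real.exp 1 ^ 2) * Real.log T)
            + η ^ 2 * L0 * (45 * expQuot (η * L1) + 14 * Real.log T)
            + 21 * η ^ 2 * L0 * Real.exp (48 * (η * L1) ^ 2)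
            + Real.exp (48 * (η * L1) ^ 2) / L1 * ‖gradient F x₁‖) := by
  simp only [hx, nsgdmIterate]
  refine ⟨fun t ht => integrable_norm_gradient_nsgdmState hsmooth hη hL0 hL1 hgrad.measurable
    hξ_meas _ x₁ ht, fun T hT => ?_⟩
  have hmain := nsgdm_expected_bound hsmooth hη hL0 hL1 hσ hbdd hgrad hξ_meas hξ_law hξ_indep
    x₁ hT
  have ha : 0 ≤ η * L1 := by positivity
  have hlog : 0 ≤ Real.log T := Real.log_natCast_nonneg T
  have hnoise : 2 * (η * σ * (1 + Real.log T)) ≤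
      η * σ * (7 + 2 * Real.sqrt (2 * Real.exp 1 ^ 2) * Real.log T) := by
    have hsq : 1 ≤ Real.sqrt (2 * Real.exp 1 ^ 2) := by
      rw [Real.one_le_sqrt]
      nlinarith [Real.add_one_le_exp (1 : ℝ)]
    calc _ = η * σ * (2 + 2 * 1 * Real.log T) := by ring
      _ ≤ _ := by gcongr; norm_num
  -- Here 45 = 42 + 3, and one of the 21 copies of the exponential L0 term is spent; the other 20 go
  -- to `hinit`.
  have hsmall : 3 * η ^ 2 * L0 * (1 + Real.log T + 3 * (Real.exp (η * L1) - 1)) ≤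
      η ^ 2 * L0 * (45 * expQuot (η * L1) + 14 * Real.log T) +
        η ^ 2 * L0 * Real.exp (48 * (η * L1) ^ 2) := by
    have h9 := nine_mul_exp_sub_one_le ha
    have h1 := one_le_expQuot ha
    calc _ = η ^ 2 * L0 * (3 + 3 * Real.log T + 9 * (Real.exp (η * L1) - 1)) := by ring
      _ ≤ η ^ 2 * L0 * (45 * expQuot (η * L1) + 14 * Real.log T +
          Real.exp (48 * (η * L1) ^ 2)) :=
          mul_le_mul_of_nonneg_left (by linarith) (by positivity)
      _ = _ := by ring
  have hinit : 84 * η * (η * L1) ^ 2 * Real.exp (28 * (η * L1) ^ 2) *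
      (28 * η * (η * L1) * L0) ≤ 20 * η ^ 2 * L0 * Real.exp (48 * (η * L1) ^ 2) := by
    have := mul_le_mul_of_nonneg_left (initial_smoothness_const_le (a := η * L1))
      (by positivity : 0 ≤ η ^ 2 * L0)
    linarith
  constructor
  · have hG : 84 * η * (η * L1) ^ 2 * Real.exp (28 * (η * L1) ^ 2) * ‖gradient F x₁‖ ≤
        6 * η * Real.exp (48 * (η * L1) ^ 2) * ‖gradient F x₁‖ := by
      have := mul_le_mul_of_nonneg_left (initial_gradient_const_le (η * L1)) hη.le
      refine mul_le_mul_of_nonneg_right ?_ (norm_nonneg _)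
      linarith
    linarith
  · intro hL
    have ha2 : 1 / 2 ≤ η * L1 := by
      rw [div_le_iff₀ (by positivity)] at hL; linarith
    have hL1' : L1 ≠ 0 := by rintro rfl; norm_num at ha2
    have hG : 84 * η * (η * L1) ^ 2 * Real.exp (28 * (η * L1) ^ 2) * ‖gradient F x₁‖ ≤
        Real.exp (48 * (η * L1) ^ 2) / L1 * ‖gradient F x₁‖ := by
      have := mul_le_mul_of_nonneg_left (initial_gradient_const_le' ha2) hη.le
      have e : η * (Real.exp (48 * (η * L1) ^ 2) / (η * L1)) =
        Real.exp (48 * (η * L1) ^ 2) / L1 := by field_simp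
      rw [e] at this
      refine mul_le_mul_of_nonneg_right ?_ (norm_nonneg _)
      linarith
    linarith
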